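/- For an irrational $x\in(0,1)$ let $x=[a_1(x),a_2(x),\ldots]$ be its simple continued fraction expansion, i.e. $a_n(x)=\lfloor 1/T^{n-1}(x)\rfloor$ for $n\ge 1$, where $T$ is the Gauss map, $T(0)=0$ and $T(x)=1/x-\lfloor 1/x\rfloor$ for $x\in(0,1)$. Put $S_n(x)=\sum_{i=1}^{n}a_i(x)a_{i+1}(x)$, and for $\phi:\mathbb N\to(0,\infty)$ let $$E(\phi)=\Big\{x\in(0,1)\ \text{irrational}:\ \lim_{n\to\infty}\frac{S_n(x)}{\phi(n)}=1\Big\}.$$ Then for every real $\alpha\ge 1/2$, if $\phi(n)=e^{n^{\alpha}}$, the Hausdorff dimension of $E(\phi)$ is exactly $1/2$. -/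

import Mathlib

open Filter Topology

noncomputable section

/-- The Gauss map `T(x) = 1/x - ⌊1/x⌋` for `x ≠ 0`, and `T(0) = 0`. -/
def gaussMap (x : ℝ) : ℝ := if x = 0 then 0 else 1 / x - (⌊1 / x⌋ : ℝ)

/-- The `n`th partial quotient `a_n(x) = ⌊1 / T^{n-1}(x)⌋`, for `n ≥ 1`, of the continued fraction
expansion `x = [a_1(x), a_2(x), …]` of an irrational `x ∈ (0, 1)`. The index `n = 0` is not used. -/
def partialQuotient (n : ℕ) (x : ℝ) : ℤ := ⌊1 / (gaussMap^[n - 1] x)⌋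

/-- `S_n(x) = ∑_{i=1}^n a_i(x) a_{i+1}(x)`. -/
def sumProd (n : ℕ) (x : ℝ) : ℤ :=
  ∑ i ∈ Finset.Icc 1 n, partialQuotient i x * partialQuotient (i + 1) x

/-- `E(φ)`: the irrational `x ∈ (0, 1)` with `S_n(x) / φ(n) → 1` as `n → ∞`. -/
def levelSet (φ : ℕ → ℝ) : Set ℝ :=
  {x : ℝ | x ∈ Set.Ioo (0 : ℝ) 1 ∧ Irrational x ∧
    Tendsto (fun n : ℕ => (sumProd n x : ℝ) / φ n) atTop (𝓝 1)}

end

open MeasureTheory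
open scoped ENNReal NNReal

noncomputable section

/-! Upper bound. Fix `s > 1/2`. The inverse branch of the Gauss map with digit `a` contracts by
`a⁻²`, so pulling a set back one step costs a finite factor `digitSum s` in Hausdorff content, and
requiring that digit to be at least `L` gains `L ^ (-(s - 1/2))`. Since `n ^ α` grows at least as
fast as `√n` (`sqrt_sub_sqrt_le_rpow_sub_rpow`), over a block of about `δ√n` indices the target `φ`
grows by a fixed factor greater than 1. The sum `S` must follow, which forces a digit of size `exp
(√n / 4)` in the block (`eventually_exists_large_digit`). For small `δ` the gain beats the block's
cost `digitSum s ^ (δ√n)`, so each block at least halves the content; chaining blocks gives content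
zero, hence `μH[s] = 0`.

Lower bound. Solve `exp (x k) * exp (x (k + 1)) = φ (k + 1) - φ k` exactly by `logDigit`, and let
the `k`th digit range over a window near `exp (x k)` of relative width about `1 / (k + 1)`. The
products are then asymptotic to the increments of `φ`, so every such point lies in the level set
(`cfValue_mem_levelSet`). The windows are indexed by mixed radix digits of `t ∈ [0, 1)`, and the map
from points back to `t` is Hölder of every exponent `r < 1/2` (`le_dimH_of_digit_windows`): after
`n` digits, `t` is known to within about `exp (-∑ x k)`, while distinct points are separated by
about `exp (-2 ∑ x k)`. The errors are negligible because `∑ x k` has order `n ^ (α + 1)`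
(`exists_sum_logDigit_le`). -/

/-! ### Hausdorff content -/

/-- The `s`-dimensional Hausdorff content on `ℝ`. -/
def hausdorffContent (s : ℝ) : OuterMeasure ℝ :=
  OuterMeasure.boundedBy fun F => Metric.ediam F ^ s

theorem hausdorffContent_image_le {s : ℝ} (hs : 0 ≤ s) {K : ℝ≥0} (hK : K ≠ 0) {f : ℝ → ℝ}
    (hf : LipschitzWith K f) (F : Set ℝ) :
    hausdorffContent s (f '' F) ≤ (K : ℝ≥0∞) ^ s * hausdorffContent s F := by
  have hK0 : (K : ℝ≥0∞) ^ s ≠ 0 := by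
    simp [ENNReal.rpow_eq_zero_iff, hK]
  have hKt : (K : ℝ≥0∞) ^ s ≠ ∞ := ENNReal.rpow_ne_top_of_nonneg hs ENNReal.coe_ne_top
  have key : ((K : ℝ≥0∞) ^ s)⁻¹ • OuterMeasure.comap f (hausdorffContent s)
      ≤ hausdorffContent s := by
    -- `boundedBy` is the largest outer measure below its gauge, so a comparison on single sets
    -- suffices.
    refine OuterMeasure.le_boundedBy.2 fun t => ?_
    rw [smul_apply, OuterMeasure.comap_apply, smul_eq_mul,
      ENNReal.inv_mul_le_iff hK0 hKt, ← ENNReal.mul_rpow_of_nonneg _ _ hs]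
    exact (OuterMeasure.boundedBy_le _).trans
      (ENNReal.rpow_le_rpow (hf.ediam_image_le t) hs)
  have := key F
  rwa [smul_apply, OuterMeasure.comap_apply, smul_eq_mul,
    ENNReal.inv_mul_le_iff hK0 hKt] at this

theorem hausdorffMeasure_eq_zero_of_hausdorffContent {s : ℝ} (hs : 0 < s) {F : Set ℝ}
    (hF : hausdorffContent s F = 0) : μH[s] F = 0 := by
  rw [Measure.hausdorffMeasure_apply, ← nonpos_iff_eq_zero]
  refine iSup₂_le fun r hr => ?_
  refine ENNReal.le_of_forall_pos_le_add fun ε hε _ => ?_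
  rw [zero_add]
  -- A cover of total cost below `r ^ s` automatically has all diameters at most `r`, as the measure
  -- requires.
  have hpos : (0 : ℝ≥0∞) < min (ε : ℝ≥0∞) (r ^ s) :=
    lt_min (by exact_mod_cast hε) (ENNReal.rpow_pos_of_nonneg hr hs.le)
  unfold hausdorffContent at hF
  rw [OuterMeasure.boundedBy_apply] at hF
  rw [← hF] at hpos
  obtain ⟨t, ht⟩ := iInf_lt_iff.1 hpos
  obtain ⟨hcov, hsum⟩ := iInf_lt_iff.1 ht
  refine iInf_le_of_le t (iInf_le_of_le hcov (iInf_le_of_le (fun n => ?_) ?_))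
  · rcases (t n).eq_empty_or_nonempty with h | h
    · simp [h]
    have h1 : Metric.ediam (t n) ^ s ≤ r ^ s := by
      refine le_trans ?_ (hsum.le.trans (min_le_right _ _))
      refine le_trans ?_ (ENNReal.le_tsum n)
      rw [iSup_pos h]
    exact (ENNReal.rpow_le_rpow_iff hs).1 h1
  · exact hsum.le.trans (min_le_left _ _)

/-! ### The Gauss map and its digits -/

/-- The irrational numbers of the open unit interval. -/
def unitIrrationals : Set ℝ := {x | x ∈ Set.Ioo (0 : ℝ) 1 ∧ Irrational x}

theorem hausdorffContent_unitIrrationals_le {s : ℝ} (hs : 0 ≤ s) :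
    hausdorffContent s unitIrrationals ≤ 1 := by
  refine (OuterMeasure.boundedBy_le _).trans ?_
  have h : Metric.ediam unitIrrationals ≤ 1 := by
    refine (Metric.ediam_mono (t := Set.Icc (0 : ℝ) 1) fun x hx => ⟨hx.1.1.le, hx.1.2.le⟩).trans ?_
    rw [Real.ediam_Icc]
    simp
  simpa using ENNReal.rpow_le_rpow h hs

theorem gaussMap_of_pos {x : ℝ} (hx : 0 < x) : gaussMap x = 1 / x - ⌊1 / x⌋ := by
  rw [gaussMap, if_neg hx.ne']

theorem gaussMap_mem_unitIrrationals {x : ℝ} (hx : x ∈ unitIrrationals) :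
    gaussMap x ∈ unitIrrationals := by
  have hirr : Irrational (gaussMap x) := by
    rw [gaussMap_of_pos hx.1.1]
    have : Irrational (1 / x) := by simpa using hx.2.inv
    exact this.sub_intCast _
  refine ⟨⟨lt_of_le_of_ne ?_ (by simpa using hirr.ne_zero.symm), ?_⟩, hirr⟩
  · rw [gaussMap_of_pos hx.1.1]
    exact sub_nonneg.2 (Int.floor_le _)
  · rw [gaussMap_of_pos hx.1.1]
    linarith [Int.lt_floor_add_one (1 / x)]

theorem iterate_gaussMap_mem_unitIrrationals {x : ℝ} (hx : x ∈ unitIrrationals) (n : ℕ) :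
    gaussMap^[n] x ∈ unitIrrationals := by
  induction n with
  | zero => exact hx
  | succ n ih =>
    rw [Function.iterate_succ_apply']
    exact gaussMap_mem_unitIrrationals ih

theorem one_le_partialQuotient {x : ℝ} (hx : x ∈ unitIrrationals) (n : ℕ) :
    1 ≤ partialQuotient n x := by
  have h := iterate_gaussMap_mem_unitIrrationals hx (n - 1)
  rw [partialQuotient, Int.le_floor]
  simpa using (one_le_div h.1.1).2 h.1.2.le

theorem partialQuotient_iterate (x : ℝ) (n i : ℕ) (hi : 1 ≤ i) :
    partialQuotient i (gaussMap^[n] x) = partialQuotient (n + i) x := by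
  rw [partialQuotient, partialQuotient, ← Function.iterate_add_apply]
  congr 4
  omega

/-! ### Content of preimages under the Gauss map -/

/-- The absolute value extends the inverse branch `y ↦ 1 / (a + y)` to a globally Lipschitz map
without changing it for `y ≥ 0`. -/
theorem lipschitzWith_inv_add_abs {a : ℝ≥0} (ha : 0 < a) :
    LipschitzWith ((a ^ 2)⁻¹) fun y : ℝ => 1 / ((a : ℝ) + |y|) := by
  refine LipschitzWith.of_dist_le_mul fun x y => ?_
  have ha' : (0 : ℝ) < a := ha
  have hx : (a : ℝ) ≤ a + |x| := by linarith [abs_nonneg x]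
  have hy : (a : ℝ) ≤ a + |y| := by linarith [abs_nonneg y]
  have e : 1 / ((a : ℝ) + |x|) - 1 / (a + |y|) = (|y| - |x|) / ((a + |x|) * (a + |y|)) := by
    field_simp
    ring
  rw [Real.dist_eq, Real.dist_eq, e, abs_div, abs_of_pos (by positivity :
    0 < ((a : ℝ) + |x|) * (a + |y|)), div_eq_inv_mul]
  push_cast
  refine mul_le_mul ?_ ?_ (abs_nonneg _) (by positivity)
  · rw [sq]
    gcongr
  · rw [abs_sub_comm x y]
    exact abs_abs_sub_abs_le _ _

theorem hausdorffContent_digit_le {s : ℝ} (hs : 0 ≤ s) (A : Set ℤ) (F : Set ℝ) :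
    hausdorffContent s {x ∈ unitIrrationals | partialQuotient 1 x ∈ A ∧ gaussMap x ∈ F} ≤
      (∑' a : ℕ, {a : ℕ | (a : ℤ) + 1 ∈ A}.indicator
        (fun a => ENNReal.ofReal (((a : ℝ) + 1) ^ (-(2 * s)))) a) * hausdorffContent s F := by
  have hsub : {x ∈ unitIrrationals | partialQuotient 1 x ∈ A ∧ gaussMap x ∈ F} ⊆
      ⋃ a : ℕ, {y | (a : ℤ) + 1 ∈ A ∧ y ∈
        (fun y : ℝ => 1 / ((((a : ℝ≥0) + 1 : ℝ≥0) : ℝ) + |y|)) '' F} := by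
    rintro x ⟨hx, hA, hF⟩
    have h1 := one_le_partialQuotient hx 1
    obtain ⟨a, ha⟩ := Int.eq_ofNat_of_zero_le (sub_nonneg.2 h1)
    have ha' : (a : ℤ) + 1 = partialQuotient 1 x := by omega
    refine Set.mem_iUnion.2 ⟨a, by rwa [ha'], gaussMap x, hF, ?_⟩
    have hg := gaussMap_mem_unitIrrationals hx
    have hq : (partialQuotient 1 x : ℝ) = ⌊1 / x⌋ := by simp [partialQuotient]
    have : ((a : ℝ) + 1) = ⌊1 / x⌋ := by rw [← hq, ← ha']; push_cast; ring
    dsimp only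
    rw [abs_of_pos hg.1.1, gaussMap_of_pos hx.1.1]
    push_cast
    rw [this]
    simp
  refine (measure_mono hsub).trans ((measure_iUnion_le _).trans ?_)
  rw [← ENNReal.tsum_mul_right]
  refine ENNReal.tsum_le_tsum fun a => ?_
  by_cases ha : (a : ℤ) + 1 ∈ A
  · rw [Set.indicator_of_mem (show a ∈ {a : ℕ | (a : ℤ) + 1 ∈ A} from ha)]
    simp only [ha, true_and]
    refine (hausdorffContent_image_le hs (by positivity)
      (lipschitzWith_inv_add_abs (a := (a : ℝ≥0) + 1) (by positivity)) F).trans (le_of_eq ?_)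
    congr 1
    rw [← ENNReal.coe_rpow_of_nonneg _ hs, ENNReal.ofReal]
    congr 1
    refine NNReal.eq ?_
    rw [Real.coe_toNNReal _ (by positivity)]
    push_cast
    rw [← Real.rpow_natCast, ← Real.rpow_neg (by positivity), ← Real.rpow_mul (by positivity)]
    push_cast
    ring_nf
  · simp [ha]

/-- The sum `∑_{a ≥ 1} a^{-(s + 1/2)}`. -/
def digitSum (s : ℝ) : ℝ≥0∞ := ∑' a : ℕ, ENNReal.ofReal (((a : ℝ) + 1) ^ (-(s + 1 / 2)))

theorem digitSum_ne_top {s : ℝ} (hs : 1 / 2 < s) : digitSum s ≠ ∞ := by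
  have h : Summable fun a : ℕ => ((a : ℝ) + 1) ^ (-(s + 1 / 2)) := by
    have := (summable_nat_add_iff 1).2 (Real.summable_nat_rpow.2 (by linarith : -(s + 1 / 2) < -1))
    simpa using this
  rw [digitSum, ← ENNReal.ofReal_tsum_of_nonneg (fun a => by positivity) h]
  exact ENNReal.ofReal_ne_top

theorem one_le_digitSum (s : ℝ) : 1 ≤ digitSum s := by
  refine le_trans ?_ (ENNReal.le_tsum 0)
  simp

/-- The exponent splits as `2s = (s - 1/2) + (s + 1/2)`: the first part pays for the size of the
digit, the second keeps the sum over digits convergent. -/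
theorem hausdorffContent_large_digit_le {s L : ℝ} (hs : 1 / 2 < s) (hL : 0 < L) (F : Set ℝ) :
    hausdorffContent s
        {x ∈ unitIrrationals | L ≤ partialQuotient 1 x ∧ gaussMap x ∈ F} ≤
      ENNReal.ofReal (L ^ (-(s - 1 / 2))) * digitSum s * hausdorffContent s F := by
  refine (hausdorffContent_digit_le (by linarith) {z : ℤ | L ≤ z} F).trans ?_
  gcongr
  rw [digitSum, ← ENNReal.tsum_mul_left]
  refine ENNReal.tsum_le_tsum fun a => ?_
  refine Set.indicator_apply_le' (fun hb => ?_) fun _ => zero_le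
  rw [← ENNReal.ofReal_mul (by positivity)]
  refine ENNReal.ofReal_le_ofReal ?_
  have hb' : L ≤ (a : ℝ) + 1 := by simpa using hb
  have : ((a : ℝ) + 1) ^ (-(2 * s)) =
      ((a : ℝ) + 1) ^ (-(s - 1 / 2)) * ((a : ℝ) + 1) ^ (-(s + 1 / 2)) := by
    rw [← Real.rpow_add (by positivity)]
    ring_nf
  rw [this]
  gcongr ?_ * _
  exact Real.rpow_le_rpow_of_nonpos hL hb' (by linarith)

theorem hausdorffContent_gaussMap_preimage_le {s : ℝ} (hs : 1 / 2 < s) (F : Set ℝ) :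
    hausdorffContent s {x ∈ unitIrrationals | gaussMap x ∈ F} ≤
      digitSum s * hausdorffContent s F := by
  have := hausdorffContent_large_digit_le hs one_pos F
  simp only [Real.one_rpow, ENNReal.ofReal_one, one_mul] at this
  refine le_trans (measure_mono ?_) this
  rintro x ⟨hx, hF⟩
  exact ⟨hx, by exact_mod_cast one_le_partialQuotient hx 1, hF⟩

theorem hausdorffContent_iterate_preimage_le {s : ℝ} (hs : 1 / 2 < s) (F : Set ℝ) (n : ℕ) :
    hausdorffContent s {x ∈ unitIrrationals | gaussMap^[n] x ∈ F} ≤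
      digitSum s ^ n * hausdorffContent s F := by
  induction n with
  | zero =>
    rw [pow_zero, one_mul]
    exact measure_mono fun x hx => hx.2
  | succ n ih =>
    refine le_trans (measure_mono ?_) ((hausdorffContent_gaussMap_preimage_le hs
      {x ∈ unitIrrationals | gaussMap^[n] x ∈ F}).trans ?_)
    · rintro x ⟨hx, hF⟩
      exact ⟨hx, gaussMap_mem_unitIrrationals hx, hF⟩
    · rw [pow_succ', mul_assoc]
      gcongr

theorem hausdorffContent_large_digit_iterate_le {s L : ℝ} (hs : 1 / 2 < s) (hL : 0 < L)
    (F : Set ℝ) {n i : ℕ} (hi : i ∈ Finset.Icc 1 n) :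
    hausdorffContent s
        {x ∈ unitIrrationals | L ≤ partialQuotient i x ∧ gaussMap^[n] x ∈ F} ≤
      ENNReal.ofReal (L ^ (-(s - 1 / 2))) * digitSum s ^ n * hausdorffContent s F := by
  obtain ⟨h1, h2⟩ := Finset.mem_Icc.1 hi
  obtain ⟨j, rfl⟩ := Nat.exists_eq_add_of_le' h1
  obtain ⟨k, rfl⟩ := Nat.exists_eq_add_of_le h2
  -- The orbit is cut into `j` free digits, one large digit, and `k` free digits.
  have hsub : {x ∈ unitIrrationals | L ≤ partialQuotient (j + 1) x ∧ gaussMap^[j + 1 + k] x ∈ F} ⊆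
      {x ∈ unitIrrationals | gaussMap^[j] x ∈ {x ∈ unitIrrationals | L ≤ partialQuotient 1 x ∧
        gaussMap x ∈ {x ∈ unitIrrationals | gaussMap^[k] x ∈ F}}} := by
    rintro x ⟨hx, hd, hF⟩
    have hj := iterate_gaussMap_mem_unitIrrationals hx j
    refine ⟨hx, hj, ?_, gaussMap_mem_unitIrrationals hj, ?_⟩
    · rwa [partialQuotient_iterate x j 1 le_rfl]
    · rw [← Function.iterate_succ_apply, ← Function.iterate_add_apply]
      convert hF using 2
      omega
  refine (measure_mono hsub).trans ((hausdorffContent_iterate_preimage_le hs _ j).trans ?_)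
  refine (mul_le_mul_right ((hausdorffContent_large_digit_le hs hL _).trans
    (mul_le_mul_right (hausdorffContent_iterate_preimage_le hs F k) _)) _).trans (le_of_eq ?_)
  ring

theorem hausdorffContent_exists_large_digit_le {s L : ℝ} (hs : 1 / 2 < s) (hL : 0 < L)
    (F : Set ℝ) (n : ℕ) :
    hausdorffContent s {x ∈ unitIrrationals |
        (∃ i ∈ Finset.Icc 1 n, L ≤ partialQuotient i x) ∧ gaussMap^[n] x ∈ F} ≤
      n * (ENNReal.ofReal (L ^ (-(s - 1 / 2))) * digitSum s ^ n) * hausdorffContent s F := by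
  have hsub : {x ∈ unitIrrationals |
      (∃ i ∈ Finset.Icc 1 n, L ≤ partialQuotient i x) ∧ gaussMap^[n] x ∈ F} ⊆
      ⋃ i ∈ Finset.Icc 1 n,
        {x ∈ unitIrrationals | L ≤ partialQuotient i x ∧ gaussMap^[n] x ∈ F} := by
    rintro x ⟨hx, ⟨i, hi, hd⟩, hF⟩
    exact Set.mem_biUnion hi ⟨hx, hd, hF⟩
  refine (measure_mono hsub).trans ((measure_biUnion_finset_le _ _).trans ?_)
  refine (Finset.sum_le_sum fun i hi =>
    hausdorffContent_large_digit_iterate_le hs hL F hi).trans (le_of_eq ?_)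
  rw [Finset.sum_const, Nat.card_Icc, nsmul_eq_mul, Nat.add_sub_cancel]
  ring

/-! ### Chaining blocks that contain a large digit -/

/-- The `y` for which, for every `j`, one of the `l (n + j)` partial quotients following the `j`th
is at least `L (n + j)`. -/
def largeDigitSet (l : ℕ → ℕ) (L : ℕ → ℝ) (n : ℕ) : Set ℝ :=
  {y ∈ unitIrrationals | ∀ j, ∃ i ∈ Finset.Icc 1 (l (n + j)), L (n + j) ≤ partialQuotient (j + i) y}

/-- Removing the first block of `l n` digits sends the set into the one with parameter `n + l n`, at
a factor of at most `1/2`. Iterating from the trivial bound 1 gives `2⁻¹ ^ j` for every `j`. -/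
theorem hausdorffContent_largeDigitSet_eq_zero {s : ℝ} (hs : 1 / 2 < s) {l : ℕ → ℕ} {L : ℕ → ℝ}
    (hL : ∀ n, 0 < L n) {N : ℕ}
    (h : ∀ n ≥ N, (l n : ℝ≥0∞) * (ENNReal.ofReal (L n ^ (-(s - 1 / 2))) * digitSum s ^ l n) ≤ 2⁻¹)
    {n : ℕ} (hn : N ≤ n) : hausdorffContent s (largeDigitSet l L n) = 0 := by
  have key : ∀ j n : ℕ, N ≤ n → hausdorffContent s (largeDigitSet l L n) ≤ 2⁻¹ ^ j := by
    intro j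
    induction j with
    | zero =>
      intro n _
      rw [pow_zero]
      exact (measure_mono fun x hx => hx.1).trans
        (hausdorffContent_unitIrrationals_le (by linarith))
    | succ j ih =>
      intro n hn
      rw [pow_succ']
      refine le_trans (measure_mono ?_) ((hausdorffContent_exists_large_digit_le hs (hL n)
        (largeDigitSet l L (n + l n)) (l n)).trans
          (mul_le_mul' (h n hn) (ih (n + l n) (by omega))))
      rintro x ⟨hx, hx'⟩
      refine ⟨hx, by simpa using hx' 0, iterate_gaussMap_mem_unitIrrationals hx _, fun k => ?_⟩
      obtain ⟨i, hi, hi'⟩ := hx' (l n + k)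
      refine ⟨i, by rwa [add_assoc], ?_⟩
      rw [partialQuotient_iterate _ _ _ (by have := (Finset.mem_Icc.1 hi).1; omega), ← add_assoc,
        add_assoc n]
      exact hi'
  refine le_antisymm (ge_of_tendsto' (ENNReal.tendsto_pow_atTop_nhds_zero_of_lt_one
    (by simp : (2⁻¹ : ℝ≥0∞) < 1)) fun j => key j n hn) zero_le

/-! ### Large digits forced by the growth of `S` -/

/-- Write `u ^ α = √u * u ^ (α - 1/2)`; the second factor is monotone, and at least 1 at `t`. -/
theorem sqrt_sub_sqrt_le_rpow_sub_rpow {α s t : ℝ} (hα : 1 / 2 ≤ α) (hs : 0 ≤ s) (hst : s ≤ t)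
    (ht : 1 ≤ t) : √t - √s ≤ t ^ α - s ^ α := by
  have hβ : 0 ≤ α - 1 / 2 := by linarith
  have e : ∀ u : ℝ, 0 ≤ u → u ^ α = √u * u ^ (α - 1 / 2) := fun u hu => by
    rw [Real.sqrt_eq_rpow, ← Real.rpow_add_of_nonneg hu (by norm_num) hβ]
    ring_nf
  rw [e t (hs.trans hst), e s hs]
  have h1 : (1 : ℝ) ≤ t ^ (α - 1 / 2) := Real.one_le_rpow ht hβ
  have h2 : s ^ (α - 1 / 2) ≤ t ^ (α - 1 / 2) := Real.rpow_le_rpow hs hst hβ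
  have h3 : √s ≤ √t := Real.sqrt_le_sqrt hst
  nlinarith [mul_le_mul_of_nonneg_left h2 (Real.sqrt_nonneg s),
    mul_le_mul_of_nonneg_left h1 (sub_nonneg.2 h3)]

theorem eventually_affine_le_mul_exp (a b : ℝ) {c ε : ℝ} (hc : 0 < c) (hε : 0 < ε) :
    ∀ᶠ u : ℝ in atTop, a * u + b ≤ ε * Real.exp (c * u) := by
  have h1 := (isLittleO_pow_exp_pos_mul_atTop 1 hc).const_mul_left a
  have h0 := (isLittleO_pow_exp_pos_mul_atTop 0 hc).const_mul_left b
  filter_upwards [(h1.add h0).def hε] with u hu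
  rw [Real.norm_of_nonneg (Real.exp_pos _).le, pow_one, pow_zero, mul_one] at hu
  exact (le_abs_self _).trans hu

theorem tendsto_sqrt_natCast : Tendsto (fun n : ℕ => √(n : ℝ)) atTop atTop :=
  Real.tendsto_sqrt_atTop.comp tendsto_natCast_atTop_atTop

theorem sumProd_sub_le {x M : ℝ} (hx : x ∈ unitIrrationals) {n k : ℕ}
    (h : ∀ i ∈ Finset.Icc 1 (k + 1), (partialQuotient (n + i) x : ℝ) ≤ M) :
    (sumProd (n + k) x : ℝ) - sumProd n x ≤ k * M ^ 2 := by
  induction k with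
  | zero => simp
  | succ k ih =>
    have ih' := ih fun i hi => h i (by rw [Finset.mem_Icc] at hi ⊢; omega)
    have e : sumProd (n + (k + 1)) x = sumProd (n + k) x +
        partialQuotient (n + (k + 1)) x * partialQuotient (n + (k + 1 + 1)) x := by
      rw [sumProd, ← add_assoc, Finset.sum_Icc_succ_top (by omega), sumProd]
      rfl
    have h1 := h (k + 1) (by rw [Finset.mem_Icc]; omega)
    have h2 := h (k + 1 + 1) (by rw [Finset.mem_Icc]; omega)
    have p1 : (1 : ℝ) ≤ partialQuotient (n + (k + 1)) x := by
      exact_mod_cast one_le_partialQuotient hx _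
    have p2 : (1 : ℝ) ≤ partialQuotient (n + (k + 1 + 1)) x := by
      exact_mod_cast one_le_partialQuotient hx _
    rw [e]
    push_cast
    nlinarith [mul_le_mul h1 h2 (by linarith) (by linarith)]

theorem eventually_exists_large_digit {α : ℝ} (hα : 1 / 2 ≤ α) {δ : ℝ} (hδ : 0 < δ) (hδ1 : δ ≤ 1)
    {x : ℝ} (hx : x ∈ levelSet fun n : ℕ => Real.exp ((n : ℝ) ^ α)) :
    ∀ᶠ n : ℕ in atTop, ∃ i ∈ Finset.Icc 1 (⌈δ * √(n : ℝ)⌉₊ + 1),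
      Real.exp (√(n : ℝ) / 4) ≤ partialQuotient (n + i) x := by
  have hxU : x ∈ unitIrrationals := ⟨hx.1, hx.2.1⟩
  -- Small enough that `(1 - ε) * (1 + δ / 3) - (1 + ε) ≥ ε`.
  set ε := δ / 12 with hεdef
  have hε : 0 < ε := by positivity
  have hlim := hx.2.2
  have hev : ∀ᶠ n : ℕ in atTop, (1 - ε) * Real.exp ((n : ℝ) ^ α) ≤ sumProd n x ∧
      (sumProd n x : ℝ) ≤ (1 + ε) * Real.exp ((n : ℝ) ^ α) := by
    filter_upwards [hlim.eventually (Icc_mem_nhds (by linarith : 1 - ε < 1)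
      (by linarith : 1 < 1 + ε))] with n hn
    exact ⟨(le_div_iff₀ (Real.exp_pos _)).1 hn.1, (div_le_iff₀ (Real.exp_pos _)).1 hn.2⟩
  obtain ⟨N, hN⟩ := eventually_atTop.1 hev
  have haff := tendsto_sqrt_natCast.eventually
    (eventually_affine_le_mul_exp δ 2 (by norm_num : (0 : ℝ) < 1 / 2) hε)
  filter_upwards [haff, eventually_ge_atTop N, eventually_ge_atTop 1] with n hn hnN hn1
  by_contra! hcon
  set k := ⌈δ * √(n : ℝ)⌉₊ with hk
  set u := √(n : ℝ) with hu
  have hn1' : (1 : ℝ) ≤ n := by exact_mod_cast hn1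
  have hu1 : 1 ≤ u := Real.one_le_sqrt.2 hn1'
  have husq : u ^ 2 = n := Real.sq_sqrt (by positivity)
  have hk1 : δ * u ≤ k := Nat.le_ceil _
  have hk2 : (k : ℝ) < δ * u + 1 := Nat.ceil_lt_add_one (by positivity)
  have hsum := sumProd_sub_le hxU (n := n) (k := k) fun i hi => (hcon i hi).le
  have hlow := (hN (n + k) (by omega)).1
  have hup := (hN n hnN).2
  have hgrow : (n : ℝ) ^ α + δ / 3 ≤ ((n + k : ℕ) : ℝ) ^ α := by
    have h1 := sqrt_sub_sqrt_le_rpow_sub_rpow hα (s := n) (t := ((n + k : ℕ) : ℝ)) (by positivity)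
      (by push_cast; linarith [(Nat.cast_nonneg k : (0 : ℝ) ≤ k)])
      (by push_cast; linarith [(Nat.cast_nonneg k : (0 : ℝ) ≤ k)])
    have h2 : u + δ / 3 ≤ √((n + k : ℕ) : ℝ) := by
      apply Real.le_sqrt_of_sq_le
      push_cast
      nlinarith [mul_le_mul_of_nonneg_left hu1 hδ.le]
    linarith
  have hbase : u ≤ (n : ℝ) ^ α := by
    have h1 := sqrt_sub_sqrt_le_rpow_sub_rpow hα (s := 0) (t := (n : ℝ)) le_rfl (by linarith) hn1'
    rw [Real.sqrt_zero, Real.zero_rpow (by linarith)] at h1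
    linarith
  have hexp : Real.exp ((n : ℝ) ^ α) * (1 + δ / 3) ≤ Real.exp (((n + k : ℕ) : ℝ) ^ α) := by
    refine le_trans ?_ (Real.exp_le_exp.2 hgrow)
    rw [Real.exp_add]
    gcongr
    linarith [Real.add_one_le_exp (δ / 3)]
  have hphi : Real.exp u ≤ Real.exp ((n : ℝ) ^ α) := Real.exp_le_exp.2 hbase
  -- If all digits are small, `S` gains at most `k * exp (u / 2)`, yet it must gain at least `ε *
  -- exp u`; `k` is only linear in `u`.
  have hL2 : Real.exp (u / 4) ^ 2 = Real.exp (1 / 2 * u) := by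
    rw [← Real.exp_nat_mul]
    push_cast
    ring_nf
  have hE : Real.exp u = Real.exp (1 / 2 * u) * Real.exp (1 / 2 * u) := by
    rw [← Real.exp_add]
    ring_nf
  rw [hL2] at hsum
  have hepos := Real.exp_pos (1 / 2 * u)
  have hpos := Real.exp_pos ((n : ℝ) ^ α)
  have hlow' : (1 - ε) * (Real.exp ((n : ℝ) ^ α) * (1 + δ / 3)) ≤ sumProd (n + k) x :=
    (mul_le_mul_of_nonneg_left hexp (by linarith)).trans hlow
  have h5 : ε * Real.exp ((n : ℝ) ^ α) ≤ k * Real.exp (1 / 2 * u) := by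
    refine le_trans ?_ ((sub_le_sub hlow' hup).trans hsum)
    have : ε ≤ (1 - ε) * (1 + δ / 3) - (1 + ε) := by rw [hεdef]; nlinarith
    nlinarith [mul_le_mul_of_nonneg_right this hpos.le]
  have h6 : ε * Real.exp u ≤ k * Real.exp (1 / 2 * u) :=
    (mul_le_mul_of_nonneg_left hphi hε.le).trans h5
  rw [hE, ← mul_assoc] at h6
  have h7 := le_of_mul_le_mul_right h6 hepos
  linarith

/-! ### The upper bound -/

theorem exists_eventually_block_factor_le {s : ℝ} (hs : 1 / 2 < s) :
    ∃ δ : ℝ, 0 < δ ∧ δ ≤ 1 ∧ ∀ᶠ n : ℕ in atTop,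
      ((⌈δ * √(n : ℝ)⌉₊ + 1 : ℕ) : ℝ≥0∞) *
        (ENNReal.ofReal (Real.exp (√(n : ℝ) / 4) ^ (-(s - 1 / 2))) *
          digitSum s ^ (⌈δ * √(n : ℝ)⌉₊ + 1)) ≤ 2⁻¹ := by
  obtain ⟨w, hw⟩ : ∃ w : ℝ≥0, digitSum s = w :=
    ⟨_, (ENNReal.coe_toNNReal (digitSum_ne_top hs)).symm⟩
  have hw1 : (1 : ℝ) ≤ w := by
    have := one_le_digitSum s
    rw [hw] at this
    exact_mod_cast this
  have hlog : 0 ≤ Real.log w := Real.log_nonneg hw1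
  set γ := s - 1 / 2 with hγ
  have hγ0 : 0 < γ := by linarith
  -- The large digit gains `exp (-γ u / 4)`. This `δ` limits the factor `w ^ l` to a constant times
  -- `exp (γ u / 8)`, leaving another `exp (γ u / 8)` to absorb `l`.
  set δ := min 1 (γ / (8 * (Real.log w + 1))) with hδ
  have hδ0 : 0 < δ := lt_min one_pos (by positivity)
  have hδw : δ * Real.log w ≤ γ / 8 := by
    have h1 : δ ≤ γ / (8 * (Real.log w + 1)) := min_le_right _ _
    rw [le_div_iff₀ (by positivity)] at h1
    nlinarith
  refine ⟨δ, hδ0, min_le_left _ _, ?_⟩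
  have haff := tendsto_sqrt_natCast.eventually
    (eventually_affine_le_mul_exp δ 2 (by positivity : (0 : ℝ) < γ / 8)
      (by positivity : (0 : ℝ) < (2 * (w : ℝ) ^ 2)⁻¹))
  filter_upwards [haff] with n hn
  set u := √(n : ℝ) with hu
  have hu0 : 0 ≤ u := Real.sqrt_nonneg _
  set l := ⌈δ * u⌉₊ + 1 with hl
  have hl2 : (l : ℝ) ≤ δ * u + 2 := by
    have := (Nat.ceil_lt_add_one (by positivity : 0 ≤ δ * u)).le
    rw [hl]
    push_cast
    linarith
  have hwl : (w : ℝ) ^ l ≤ (w : ℝ) ^ 2 * Real.exp (γ / 8 * u) := by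
    have h1 : (w : ℝ) ^ l ≤ (w : ℝ) ^ (δ * u + 2) := by
      rw [← Real.rpow_natCast]
      exact Real.rpow_le_rpow_of_exponent_le hw1 hl2
    refine h1.trans ?_
    rw [Real.rpow_add (by linarith), mul_comm]
    refine mul_le_mul (le_of_eq (by norm_cast)) ?_ (by positivity) (by positivity)
    rw [Real.rpow_def_of_pos (by linarith)]
    exact Real.exp_le_exp.2 (by nlinarith)
  have hLexp : Real.exp (u / 4) ^ (-γ) = (Real.exp (γ / 8 * u) ^ 2)⁻¹ := by
    rw [← Real.exp_mul, ← Real.exp_nat_mul, ← Real.exp_neg]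
    push_cast
    ring_nf
  have hreal : (l : ℝ) * (Real.exp (u / 4) ^ (-γ) * (w : ℝ) ^ l) ≤ 2⁻¹ := by
    have hE := Real.exp_pos (γ / 8 * u)
    calc (l : ℝ) * (Real.exp (u / 4) ^ (-γ) * (w : ℝ) ^ l)
        ≤ (2 * (w : ℝ) ^ 2)⁻¹ * Real.exp (γ / 8 * u) *
          ((Real.exp (γ / 8 * u) ^ 2)⁻¹ * ((w : ℝ) ^ 2 * Real.exp (γ / 8 * u))) := by
          rw [hLexp]
          gcongr
          exact hl2.trans hn
      _ = 2⁻¹ := by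
          have : (w : ℝ) ≠ 0 := by linarith
          field_simp
  rw [hw]
  have e1 : ((l : ℕ) : ℝ≥0∞) = ENNReal.ofReal l := by simp
  have e2 : (w : ℝ≥0∞) = ENNReal.ofReal w := by simp
  have e3 : (2⁻¹ : ℝ≥0∞) = ENNReal.ofReal 2⁻¹ := by
    rw [ENNReal.ofReal_inv_of_pos (by norm_num)]; simp
  rw [e1, e2, e3, ← ENNReal.ofReal_pow (by positivity), ← ENNReal.ofReal_mul (by positivity),
    ← ENNReal.ofReal_mul (by positivity)]
  exact ENNReal.ofReal_le_ofReal hreal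

theorem hausdorffMeasure_levelSet_eq_zero {α : ℝ} (hα : 1 / 2 ≤ α) {s : ℝ} (hs : 1 / 2 < s) :
    μH[s] (levelSet fun n : ℕ => Real.exp ((n : ℝ) ^ α)) = 0 := by
  obtain ⟨δ, hδ0, hδ1, hev⟩ := exists_eventually_block_factor_le hs
  obtain ⟨N, hN⟩ := eventually_atTop.1 hev
  refine hausdorffMeasure_eq_zero_of_hausdorffContent (by linarith) ?_
  set l : ℕ → ℕ := fun n => ⌈δ * √(n : ℝ)⌉₊ + 1
  set L : ℕ → ℝ := fun n => Real.exp (√(n : ℝ) / 4)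
  -- The index at which large digits start depends on `x`, hence the countable union; adding `N`
  -- puts every block where the halving estimate holds.
  have hsub : (levelSet fun n : ℕ => Real.exp ((n : ℝ) ^ α)) ⊆
      ⋃ n : ℕ, {x ∈ unitIrrationals | gaussMap^[n + N] x ∈ largeDigitSet l L (n + N)} := by
    intro x hx
    have hxU : x ∈ unitIrrationals := ⟨hx.1, hx.2.1⟩
    obtain ⟨M, hM⟩ := eventually_atTop.1 (eventually_exists_large_digit hα hδ0 hδ1 hx)
    refine Set.mem_iUnion.2 ⟨M, hxU, iterate_gaussMap_mem_unitIrrationals hxU _, fun j => ?_⟩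
    obtain ⟨i, hi, hi'⟩ := hM (M + N + j) (by omega)
    refine ⟨i, hi, ?_⟩
    rw [partialQuotient_iterate _ _ _ (by have := (Finset.mem_Icc.1 hi).1; omega), ← add_assoc]
    exact hi'
  refine measure_mono_null hsub (measure_iUnion_null fun n => ?_)
  refine le_antisymm ((hausdorffContent_iterate_preimage_le hs _ _).trans ?_) zero_le
  rw [hausdorffContent_largeDigitSet_eq_zero hs (fun n => Real.exp_pos _) hN (by omega), mul_zero]

theorem dimH_levelSet_le {α : ℝ} (hα : 1 / 2 ≤ α) :
    dimH (levelSet fun n : ℕ => Real.exp ((n : ℝ) ^ α)) ≤ 1 / 2 := by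
  have e : (1 / 2 : ℝ≥0∞) = ((1 / 2 : ℝ≥0) : ℝ≥0∞) := by simp
  rw [e]
  refine ENNReal.le_of_forall_pos_le_add fun ε hε _ => ?_
  rw [← ENNReal.coe_add]
  refine dimH_le_of_hausdorffMeasure_ne_top ?_
  rw [hausdorffMeasure_levelSet_eq_zero hα]
  · exact ENNReal.zero_ne_top
  · push_cast
    have : (0 : ℝ) < ε := hε
    linarith

/-! ### Continued fractions with prescribed digits -/

/-- The `n`th convergent of the continued fraction with partial quotients `d 0, d 1, …`. -/
def convergent : ℕ → (ℕ → ℕ) → ℝ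
  | 0, _ => 0
  | n + 1, d => 1 / (d 0 + |convergent n fun k => d (k + 1)|)

/-- The value of the continued fraction with partial quotients `d 0, d 1, …`. -/
def cfValue (d : ℕ → ℕ) : ℝ := limUnder atTop fun n => convergent n d

/-- With all digits at least 2 every inverse branch contracts by at least `1/4`, so the convergents
are Cauchy. -/
theorem dist_convergent_succ_le {d : ℕ → ℕ} (hd : ∀ k, 2 ≤ d k) (n : ℕ) :
    dist (convergent n d) (convergent (n + 1) d) ≤ 1 * (1 / 2) ^ n := by
  induction n generalizing d with
  | zero =>
    have h : (2 : ℝ) ≤ d 0 := by exact_mod_cast hd 0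
    simp only [convergent, Real.dist_eq, abs_zero, add_zero, zero_sub, abs_neg, pow_zero, mul_one]
    rw [abs_of_nonneg (by positivity), div_le_one (by linarith)]
    linarith
  | succ n ih =>
    have h : (2 : ℝ) ≤ d 0 := by exact_mod_cast hd 0
    have hpos : (0 : ℝ≥0) < d 0 := by exact_mod_cast (by linarith : (0 : ℝ) < d 0)
    refine ((lipschitzWith_inv_add_abs hpos).dist_le_mul _ _).trans ?_
    rw [pow_succ' _ n, one_mul]
    have ih' := ih (d := fun k => d (k + 1)) fun k => hd _
    rw [one_mul] at ih'
    refine mul_le_mul ?_ ih' dist_nonneg (by norm_num)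
    push_cast
    rw [one_div]
    exact inv_anti₀ (by norm_num) (by nlinarith)

theorem tendsto_convergent {d : ℕ → ℕ} (hd : ∀ k, 2 ≤ d k) :
    Tendsto (fun n => convergent n d) atTop (𝓝 (cfValue d)) :=
  (cauchySeq_of_le_geometric _ _ (by norm_num) (dist_convergent_succ_le hd)).tendsto_limUnder

theorem cfValue_eq_abs {d : ℕ → ℕ} (hd : ∀ k, 2 ≤ d k) :
    cfValue d = 1 / (d 0 + |cfValue fun k => d (k + 1)|) := by
  have h0 : (2 : ℝ) ≤ d 0 := by exact_mod_cast hd 0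
  refine tendsto_nhds_unique ((tendsto_add_atTop_iff_nat 1).2 (tendsto_convergent hd)) ?_
  have h := (tendsto_convergent (d := fun k => d (k + 1)) fun k => hd _).abs
  exact tendsto_const_nhds.div (tendsto_const_nhds.add h) (by positivity)

theorem cfValue_pos {d : ℕ → ℕ} (hd : ∀ k, 2 ≤ d k) : 0 < cfValue d := by
  have h0 : (2 : ℝ) ≤ d 0 := by exact_mod_cast hd 0
  rw [cfValue_eq_abs hd]
  positivity

theorem cfValue_le_half {d : ℕ → ℕ} (hd : ∀ k, 2 ≤ d k) : cfValue d ≤ 1 / 2 := by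
  have h0 : (2 : ℝ) ≤ d 0 := by exact_mod_cast hd 0
  rw [cfValue_eq_abs hd]
  refine one_div_le_one_div_of_le (by norm_num) ?_
  linarith [abs_nonneg (cfValue fun k => d (k + 1))]

theorem cfValue_eq {d : ℕ → ℕ} (hd : ∀ k, 2 ≤ d k) :
    cfValue d = 1 / (d 0 + cfValue fun k => d (k + 1)) := by
  rw [cfValue_eq_abs hd, abs_of_pos (cfValue_pos fun k => hd _)]

theorem floor_one_div_cfValue {d : ℕ → ℕ} (hd : ∀ k, 2 ≤ d k) : ⌊1 / cfValue d⌋ = (d 0 : ℤ) := by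
  have h1 := cfValue_pos (d := fun k => d (k + 1)) fun k => hd _
  have h2 := cfValue_le_half (d := fun k => d (k + 1)) fun k => hd _
  rw [cfValue_eq hd, one_div_one_div, Int.floor_eq_iff]
  push_cast
  constructor <;> linarith

theorem gaussMap_cfValue {d : ℕ → ℕ} (hd : ∀ k, 2 ≤ d k) :
    gaussMap (cfValue d) = cfValue fun k => d (k + 1) := by
  rw [gaussMap_of_pos (cfValue_pos hd), floor_one_div_cfValue hd, cfValue_eq hd, one_div_one_div]
  push_cast
  ring

theorem iterate_gaussMap_cfValue {d : ℕ → ℕ} (hd : ∀ k, 2 ≤ d k) (n : ℕ) :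
    gaussMap^[n] (cfValue d) = cfValue fun k => d (k + n) := by
  induction n with
  | zero => rfl
  | succ n ih =>
    rw [Function.iterate_succ_apply', ih, gaussMap_cfValue fun k => hd _]
    congr 1
    ext k
    congr 1
    ring

theorem partialQuotient_cfValue {d : ℕ → ℕ} (hd : ∀ k, 2 ≤ d k) (n : ℕ) :
    partialQuotient (n + 1) (cfValue d) = d n := by
  rw [partialQuotient, Nat.add_sub_cancel, iterate_gaussMap_cfValue hd,
    floor_one_div_cfValue fun k => hd _, zero_add]

/-- The Gauss map lowers the denominator of a rational number, so its orbit reaches `0`. -/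
theorem exists_iterate_gaussMap_nonpos (q : ℕ) (x : ℝ) (p : ℤ) (hq : 0 < q) (hx1 : x < 1)
    (hp : x * q = p) : ∃ n, gaussMap^[n] x ≤ 0 := by
  induction q using Nat.strong_induction_on generalizing x p with
  | _ q ih =>
    by_cases hx0 : x ≤ 0
    · exact ⟨0, hx0⟩
    push Not at hx0
    have hq' : (0 : ℝ) < q := by exact_mod_cast hq
    have hp0 : 0 < p := by
      have : (0 : ℝ) < p := hp ▸ mul_pos hx0 hq'
      exact_mod_cast this
    lift p to ℕ using hp0.le
    have hpq : p < q := by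
      have : (p : ℝ) < q := by
        have e : x * q = (p : ℝ) := by exact_mod_cast hp
        nlinarith
      exact_mod_cast this
    have hpR : (0 : ℝ) < p := by exact_mod_cast hp0
    -- One Euclidean step: `p / q` is sent to `(q - ⌊q / p⌋ * p) / p`.
    obtain ⟨n, hn⟩ := ih p hpq (gaussMap x) (q - ⌊1 / x⌋ * p) (by exact_mod_cast hp0)
      (by
        rw [gaussMap_of_pos hx0]
        linarith [Int.lt_floor_add_one (1 / x)])
      (by
        rw [gaussMap_of_pos hx0]
        push_cast
        have e : x * q = (p : ℝ) := by exact_mod_cast hp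
        rw [sub_mul, ← e]
        field_simp)
    exact ⟨n + 1, hn⟩

theorem cfValue_mem_unitIrrationals {d : ℕ → ℕ} (hd : ∀ k, 2 ≤ d k) :
    cfValue d ∈ unitIrrationals := by
  have h1 : cfValue d < 1 := by linarith [cfValue_le_half hd]
  refine ⟨⟨cfValue_pos hd, h1⟩, ?_⟩
  rintro ⟨x, hx⟩
  obtain ⟨n, hn⟩ := exists_iterate_gaussMap_nonpos x.den (cfValue d) x.num x.pos h1 (by
    rw [← hx]
    exact_mod_cast Rat.mul_den_eq_num x)
  rw [iterate_gaussMap_cfValue hd] at hn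
  exact absurd (cfValue_pos (d := fun k => d (k + n)) fun k => hd _) (not_lt.2 hn)

theorem sumProd_cfValue {d : ℕ → ℕ} (hd : ∀ k, 2 ≤ d k) (n : ℕ) :
    (sumProd n (cfValue d) : ℝ) = ∑ k ∈ Finset.range n, (d k : ℝ) * d (k + 1) := by
  induction n with
  | zero => simp [sumProd]
  | succ n ih =>
    rw [Finset.sum_range_succ, ← ih, sumProd, Finset.sum_Icc_succ_top (by omega),
      partialQuotient_cfValue hd, partialQuotient_cfValue hd, sumProd]
    push_cast
    rfl

theorem abs_one_div_sub_one_div {a b : ℝ} (ha : 0 < a) (hb : 0 < b) :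
    |1 / a - 1 / b| = |a - b| / (a * b) := by
  rw [div_sub_div _ _ ha.ne' hb.ne', abs_div, abs_of_pos (mul_pos ha hb), one_mul, mul_one,
    abs_sub_comm]

/-- Each inverse branch divides distances by at most `D k ^ 2`. At the first disagreement the digits
differ by at least 1 and the tails, lying in `(0, 1/2]`, can cancel at most half of that; this is
the factor 2. -/
theorem inv_prod_le_abs_cfValue_sub {d e : ℕ → ℕ} {D : ℕ → ℝ} (hd : ∀ k, 2 ≤ d k)
    (he : ∀ k, 2 ≤ e k) (hdD : ∀ k, (d k : ℝ) + 1 ≤ D k) (heD : ∀ k, (e k : ℝ) + 1 ≤ D k) {n : ℕ}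
    (heq : ∀ k < n, d k = e k) (hne : d n ≠ e n) :
    (2 * ∏ k ∈ Finset.range (n + 1), D k ^ 2)⁻¹ ≤ |cfValue d - cfValue e| := by
  induction n generalizing d e D with
  | zero =>
    have hd1 := cfValue_pos (d := fun k => d (k + 1)) fun k => hd _
    have hd2 := cfValue_le_half (d := fun k => d (k + 1)) fun k => hd _
    have he1 := cfValue_pos (d := fun k => e (k + 1)) fun k => he _
    have he2 := cfValue_le_half (d := fun k => e (k + 1)) fun k => he _
    have h1 := hdD 0
    have h2 := heD 0
    have hd0 : (0 : ℝ) ≤ d 0 := Nat.cast_nonneg _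
    have he0 : (0 : ℝ) ≤ e 0 := Nat.cast_nonneg _
    rw [cfValue_eq hd, cfValue_eq he, abs_one_div_sub_one_div (by linarith) (by linarith), zero_add,
      Finset.prod_range_one, mul_inv, ← div_eq_mul_inv]
    refine div_le_div₀ (abs_nonneg _) ?_ (by positivity) ?_
    · rcases lt_or_gt_of_ne hne with h | h
      · have h' : (d 0 : ℝ) + 1 ≤ e 0 := by exact_mod_cast h
        rw [abs_sub_comm]
        exact le_trans (by linarith) (le_abs_self _)
      · have h' : (e 0 : ℝ) + 1 ≤ d 0 := by exact_mod_cast h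
        exact le_trans (by linarith) (le_abs_self _)
    · rw [sq]
      exact mul_le_mul (by linarith) (by linarith) (by linarith) (by linarith)
  | succ n ih =>
    have hd1 := cfValue_pos (d := fun k => d (k + 1)) fun k => hd _
    have hd2 := cfValue_le_half (d := fun k => d (k + 1)) fun k => hd _
    have he1 := cfValue_pos (d := fun k => e (k + 1)) fun k => he _
    have he2 := cfValue_le_half (d := fun k => e (k + 1)) fun k => he _
    have h1 := hdD 0
    have h2 := heD 0
    have hd0 : (0 : ℝ) ≤ d 0 := Nat.cast_nonneg _
    have he0 : (0 : ℝ) ≤ e 0 := Nat.cast_nonneg _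
    have ih' := ih (d := fun k => d (k + 1)) (e := fun k => e (k + 1)) (D := fun k => D (k + 1))
      (fun k => hd _) (fun k => he _) (fun k => hdD _) (fun k => heD _)
      (fun k hk => heq _ (by omega)) hne
    have h0 : (d 0 : ℝ) = e 0 := by rw [heq 0 (by omega)]
    rw [cfValue_eq hd, cfValue_eq he, abs_one_div_sub_one_div (by linarith) (by linarith),
      Finset.prod_range_succ', ← mul_assoc, mul_inv, ← div_eq_mul_inv]
    refine div_le_div₀ (abs_nonneg _) ?_ (by positivity) ?_
    · rw [h0, add_sub_add_left_eq_sub]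
      exact ih'
    · rw [sq]
      exact mul_le_mul (by linarith) (by linarith) (by linarith) (by linarith)

/-! ### Mixed radix expansions and the dimension of digit windows -/

/-- The remainders of the mixed radix expansion of `t ∈ [0, 1)` with radices `N 0, N 1, …`. -/
def radixRem (N : ℕ → ℕ) (t : ℝ) : ℕ → ℝ
  | 0 => t
  | n + 1 => Int.fract (N n * radixRem N t n)

/-- The digits of the mixed radix expansion of `t ∈ [0, 1)` with radices `N 0, N 1, …`. -/
def radixDigit (N : ℕ → ℕ) (t : ℝ) (n : ℕ) : ℕ := ⌊N n * radixRem N t n⌋₊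

theorem radixRem_mem {N : ℕ → ℕ} {t : ℝ} (ht : t ∈ Set.Ico (0 : ℝ) 1) (n : ℕ) :
    radixRem N t n ∈ Set.Ico (0 : ℝ) 1 := by
  cases n with
  | zero => exact ht
  | succ n => exact ⟨Int.fract_nonneg _, Int.fract_lt_one _⟩

theorem radixDigit_lt {N : ℕ → ℕ} (hN : ∀ k, 1 ≤ N k) {t : ℝ} (ht : t ∈ Set.Ico (0 : ℝ) 1) (n : ℕ) :
    radixDigit N t n < N n := by
  have h := radixRem_mem (N := N) ht n
  have hn : (0 : ℝ) < N n := by exact_mod_cast hN n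
  rw [radixDigit, Nat.floor_lt (mul_nonneg hn.le h.1)]
  nlinarith [h.2]

theorem radixRem_succ {N : ℕ → ℕ} {t : ℝ} (ht : t ∈ Set.Ico (0 : ℝ) 1) (n : ℕ) :
    radixRem N t (n + 1) = N n * radixRem N t n - radixDigit N t n := by
  have h : 0 ≤ N n * radixRem N t n := mul_nonneg (Nat.cast_nonneg _) (radixRem_mem ht n).1
  rw [radixRem, radixDigit, natCast_floor_eq_intCast_floor h]
  rfl

theorem prod_mul_sub_eq_radixRem_sub {N : ℕ → ℕ} {s t : ℝ} (hs : s ∈ Set.Ico (0 : ℝ) 1)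
    (ht : t ∈ Set.Ico (0 : ℝ) 1) {n : ℕ} (h : ∀ k < n, radixDigit N s k = radixDigit N t k) :
    (∏ k ∈ Finset.range n, (N k : ℝ)) * (s - t) = radixRem N s n - radixRem N t n := by
  induction n with
  | zero => simp [radixRem]
  | succ n ih =>
    rw [Finset.prod_range_succ, radixRem_succ hs, radixRem_succ ht, h n (by omega),
      sub_sub_sub_cancel_right, ← mul_sub, ← ih fun k hk => h k (by omega)]
    ring

theorem abs_sub_le_inv_prod {N : ℕ → ℕ} (hN : ∀ k, 1 ≤ N k) {s t : ℝ} (hs : s ∈ Set.Ico (0 : ℝ) 1)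
    (ht : t ∈ Set.Ico (0 : ℝ) 1) {n : ℕ} (h : ∀ k < n, radixDigit N s k = radixDigit N t k) :
    |s - t| ≤ (∏ k ∈ Finset.range n, (N k : ℝ))⁻¹ := by
  have hpos : 0 < ∏ k ∈ Finset.range n, (N k : ℝ) :=
    Finset.prod_pos fun k _ => by exact_mod_cast hN k
  have hs' := radixRem_mem (N := N) hs n
  have ht' := radixRem_mem (N := N) ht n
  have e := congrArg abs (prod_mul_sub_eq_radixRem_sub hs ht h)
  rw [abs_mul, abs_of_pos hpos] at e
  rw [← one_div, le_div_iff₀' hpos, e, abs_le]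
  constructor <;> linarith [hs'.1, hs'.2, ht'.1, ht'.2]

/-- Radix digits of `t` select the continued fraction digits. The hypothesis compares the closeness
of `s, t` with the separation of their images, so decoding is `r`-Hölder from a subset of `K` onto
`[0, 1)`, which has dimension 1. -/
theorem le_dimH_of_digit_windows {K : Set ℝ} {m N : ℕ → ℕ} (hm : ∀ k, 2 ≤ m k) (hN : ∀ k, 1 ≤ N k)
    (hK : ∀ d : ℕ → ℕ, (∀ k, m k ≤ d k ∧ d k < m k + N k) → cfValue d ∈ K) {r C : ℝ≥0} (hr : 0 < r)
    (h : ∀ n, (2 * ∏ k ∈ Finset.range (n + 1), ((m k : ℝ) + N k) ^ 2) ^ (r : ℝ) ≤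
      C * ∏ k ∈ Finset.range n, (N k : ℝ)) :
    (r : ℝ≥0∞) ≤ dimH K := by
  set I : Set ℝ := Set.Ico 0 1
  set d : ℝ → ℕ → ℕ := fun t k => m k + radixDigit N t k with hd
  have hd2 : ∀ t k, 2 ≤ d t k := fun t k => (hm k).trans (Nat.le_add_right _ _)
  have hdlt : ∀ t ∈ I, ∀ k, d t k < m k + N k := fun t ht k =>
    Nat.add_lt_add_left (radixDigit_lt hN ht k) _
  have hdD : ∀ t ∈ I, ∀ k, (d t k : ℝ) + 1 ≤ (m k : ℝ) + N k := fun t ht k => by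
    exact_mod_cast hdlt t ht k
  set G : ℝ → ℝ := fun t => cfValue (d t) with hG
  have hprod : ∀ n, 0 < ∏ k ∈ Finset.range n, (N k : ℝ) := fun n =>
    Finset.prod_pos fun k _ => by exact_mod_cast hN k
  have hbase : ∀ k, (3 : ℝ) ≤ (m k : ℝ) + N k := fun k => by
    exact_mod_cast Nat.add_le_add (hm k) (hN k)
  have hDpos : ∀ n, 0 < 2 * ∏ k ∈ Finset.range n, ((m k : ℝ) + N k) ^ 2 := fun n =>
    mul_pos two_pos (Finset.prod_pos fun k _ => by have := hbase k; positivity)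
  have hanti : ∀ s ∈ I, ∀ t ∈ I, |s - t| ≤ C * |G s - G t| ^ (r : ℝ) := by
    intro s hs t ht
    by_cases hst : ∃ n, d s n ≠ d t n
    · classical
      set n := Nat.find hst with hn
      have hne : d s n ≠ d t n := Nat.find_spec hst
      have heq : ∀ k < n, d s k = d t k := fun k hk => by
        by_contra hcon
        exact Nat.find_min hst hk hcon
      have h1 := abs_sub_le_inv_prod hN hs ht (n := n) fun k hk => Nat.add_left_cancel (heq k hk)
      have h2 := inv_prod_le_abs_cfValue_sub (hd2 s) (hd2 t) (hdD s hs) (hdD t ht) heq hne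
      have h3 := Real.rpow_le_rpow (inv_nonneg.2 (hDpos (n + 1)).le) h2 r.coe_nonneg
      rw [Real.inv_rpow (hDpos (n + 1)).le] at h3
      refine h1.trans (le_trans ?_ (mul_le_mul_of_nonneg_left h3 C.coe_nonneg))
      rw [← div_eq_mul_inv, inv_eq_one_div,
        div_le_div_iff₀ (hprod n) (Real.rpow_pos_of_pos (hDpos _) _), one_mul]
      exact h n
    -- When all digits agree, `|s - t| * (2 ^ r) ^ n` stays bounded, so `s = t`.
    · push Not at hst
      have h0 : ∀ n, |s - t| * (2 ^ (r : ℝ)) ^ n ≤ C := by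
        intro n
        have h1 := abs_sub_le_inv_prod hN hs ht (n := n) fun k hk => Nat.add_left_cancel (hst k)
        have h2 : ((2 : ℝ) ^ (r : ℝ)) ^ n ≤ C * ∏ k ∈ Finset.range n, (N k : ℝ) := by
          refine le_trans ?_ (h n)
          rw [← Real.rpow_natCast, ← Real.rpow_mul (by norm_num), mul_comm,
            Real.rpow_mul (by norm_num), Real.rpow_natCast]
          refine Real.rpow_le_rpow (by positivity) ?_ r.coe_nonneg
          have h3 : (2 : ℝ) ^ (n + 1) ≤ ∏ k ∈ Finset.range (n + 1), ((m k : ℝ) + N k) ^ 2 := by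
            rw [← Finset.card_range (n + 1), ← Finset.prod_const, Finset.card_range]
            exact Finset.prod_le_prod (fun _ _ => by norm_num) fun k _ => by nlinarith [hbase k]
          rw [pow_succ] at h3
          have : (0 : ℝ) < 2 ^ n := by positivity
          linarith
        calc |s - t| * (2 ^ (r : ℝ)) ^ n
            ≤ (∏ k ∈ Finset.range n, (N k : ℝ))⁻¹ * (C * ∏ k ∈ Finset.range n, (N k : ℝ)) :=
              mul_le_mul h1 h2 (by positivity) (inv_nonneg.2 (hprod n).le)
          _ = C := by
              have := (hprod n).ne'
              field_simp
      have hst' : |s - t| = 0 := by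
        by_contra hne
        have hpos : 0 < |s - t| := lt_of_le_of_ne (abs_nonneg _) (Ne.symm hne)
        obtain ⟨n, hn⟩ := pow_unbounded_of_one_lt ((C : ℝ) / |s - t|)
          (Real.one_lt_rpow one_lt_two (by exact_mod_cast hr : (0 : ℝ) < r))
        rw [div_lt_iff₀ hpos] at hn
        linarith [h0 n, mul_comm |s - t| (((2 : ℝ) ^ (r : ℝ)) ^ n)]
      rw [hst']
      positivity
  have hinj : Set.InjOn G I := by
    intro s hs t ht hst
    have h1 := hanti s hs t ht
    rw [hst, sub_self, abs_zero, Real.zero_rpow (by exact_mod_cast hr.ne'), mul_zero] at h1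
    exact sub_eq_zero.1 (abs_nonpos_iff.1 h1)
  have hhold : HolderOnWith C r (Function.invFunOn G I) (G '' I) := by
    rintro _ ⟨s, hs, rfl⟩ _ ⟨t, ht, rfl⟩
    rw [hinj.leftInvOn_invFunOn hs, hinj.leftInvOn_invFunOn ht, edist_dist, edist_dist,
      Real.dist_eq, Real.dist_eq, ENNReal.ofReal_rpow_of_nonneg (abs_nonneg _) r.coe_nonneg,
      ← ENNReal.ofReal_coe_nnreal, ← ENNReal.ofReal_mul C.coe_nonneg]
    exact ENNReal.ofReal_le_ofReal (hanti s hs t ht)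
  have himg : Function.invFunOn G I '' (G '' I) = I := by
    rw [← Set.image_comp]
    exact (hinj.leftInvOn_invFunOn.image_image ▸ Set.image_comp _ _ _ : _)
  have hdim : dimH I = 1 := by
    have := Real.dimH_of_nonempty_interior (s := I) (by simp [I])
    simpa using this
  have hle := hhold.dimH_image_le hr
  rw [himg, hdim, ENNReal.le_div_iff_mul_le (Or.inl (by exact_mod_cast hr.ne'))
    (Or.inl ENNReal.coe_ne_top), one_mul] at hle
  refine hle.trans (dimH_mono ?_)
  rintro _ ⟨t, ht, rfl⟩
  exact hK _ fun k => ⟨Nat.le_add_right _ _, hdlt t ht k⟩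

/-! ### The logarithmic digit sequence -/

/-- The increment `exp ((k + 1) ^ α) - exp (k ^ α)`. -/
def expIncrement (α : ℝ) (k : ℕ) : ℝ := Real.exp (((k + 1 : ℕ) : ℝ) ^ α) - Real.exp ((k : ℝ) ^ α)

/-- The sequence `x` with `x 0 = 0` and `exp (x k) * exp (x (k + 1)) = expIncrement α k`. -/
def logDigit (α : ℝ) : ℕ → ℝ
  | 0 => 0
  | k + 1 => Real.log (expIncrement α k) - logDigit α k

theorem one_div_two_mul_sqrt_le {t : ℝ} (ht : 0 ≤ t) :
    1 / (2 * √(t + 1)) ≤ √(t + 1) - √t := by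
  have h1 : 0 < √(t + 1) := Real.sqrt_pos.2 (by linarith)
  have h2 := Real.sq_sqrt (show 0 ≤ t + 1 by linarith)
  have h3 := Real.sq_sqrt ht
  rw [div_le_iff₀ (by positivity)]
  nlinarith [sq_nonneg (√(t + 1) - √t)]

theorem expIncrement_ge {α : ℝ} (hα : 1 / 2 ≤ α) (k : ℕ) :
    Real.exp ((k : ℝ) ^ α) / (2 * √((k : ℝ) + 1)) ≤ expIncrement α k := by
  have hk : (0 : ℝ) ≤ k := Nat.cast_nonneg k
  have h1 := one_div_two_mul_sqrt_le hk
  have h2 := sqrt_sub_sqrt_le_rpow_sub_rpow hα hk (by linarith : (k : ℝ) ≤ k + 1) (by linarith)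
  have h3 := Real.add_one_le_exp (((k : ℝ) + 1) ^ α - (k : ℝ) ^ α)
  have h4 : Real.exp (((k : ℝ) + 1) ^ α) =
      Real.exp ((k : ℝ) ^ α) * Real.exp (((k : ℝ) + 1) ^ α - (k : ℝ) ^ α) := by
    rw [← Real.exp_add]
    ring_nf
  rw [expIncrement]
  push_cast
  rw [h4, div_eq_mul_one_div]
  nlinarith [mul_le_mul_of_nonneg_left (h1.trans (h2.trans (by linarith :
    ((k : ℝ) + 1) ^ α - (k : ℝ) ^ α ≤ Real.exp (((k : ℝ) + 1) ^ α - (k : ℝ) ^ α) - 1)))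
    (Real.exp_pos ((k : ℝ) ^ α)).le]

theorem expIncrement_pos {α : ℝ} (hα : 1 / 2 ≤ α) (k : ℕ) : 0 < expIncrement α k :=
  lt_of_lt_of_le (by positivity) (expIncrement_ge hα k)

theorem log_expIncrement_le {α : ℝ} (hα : 1 / 2 ≤ α) (k : ℕ) :
    Real.log (expIncrement α k) ≤ ((k + 1 : ℕ) : ℝ) ^ α := by
  rw [Real.log_le_iff_le_exp (expIncrement_pos hα k), expIncrement]
  linarith [Real.exp_pos ((k : ℝ) ^ α)]

theorem le_log_expIncrement {α : ℝ} (hα : 1 / 2 ≤ α) (k : ℕ) :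
    (k : ℝ) ^ α - Real.log (2 * √((k : ℝ) + 1)) ≤ Real.log (expIncrement α k) := by
  have h := Real.log_le_log (by positivity) (expIncrement_ge hα k)
  rwa [Real.log_div (Real.exp_pos _).ne' (by positivity), Real.log_exp] at h

theorem hasDerivAt_exp_rpow (α : ℝ) {t : ℝ} (ht : 0 < t) :
    HasDerivAt (fun t : ℝ => Real.exp (t ^ α)) (Real.exp (t ^ α) * (α * t ^ (α - 1))) t :=
  (Real.hasDerivAt_rpow_const (Or.inl ht.ne')).exp

/-- By Cauchy's mean value theorem the ratio of consecutive increments is `exp ((c + 1) ^ α - c ^ α)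
* ((c + 1) / c) ^ (α - 1)` for some `c ∈ (k, k + 1)`. In the logarithm, the first factor gives at
least `3 / (8√k)` and the second loses at most `1 / (8√k)`, as `α - 1 ≥ -1/2` and `k ≥ 16`. -/
theorem sqrt_sub_sqrt_div_le_log_expIncrement_sub {α : ℝ} (hα : 1 / 2 ≤ α) {k : ℕ} (hk : 16 ≤ k) :
    (√((k : ℝ) + 2) - √(k : ℝ)) / 8 ≤
      Real.log (expIncrement α (k + 1)) - Real.log (expIncrement α k) := by
  have hk' : (16 : ℝ) ≤ k := by exact_mod_cast hk
  have hd : ∀ t : ℝ, 0 < t → HasDerivAt (fun t : ℝ => Real.exp ((t + 1) ^ α))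
      (Real.exp ((t + 1) ^ α) * (α * (t + 1) ^ (α - 1))) t := fun t ht =>
    (hasDerivAt_exp_rpow α (by linarith : 0 < t + 1)).comp_add_const t 1
  obtain ⟨c, ⟨hc1, hc2⟩, hc⟩ := exists_ratio_hasDerivAt_eq_ratio_slope
    (fun t : ℝ => Real.exp ((t + 1) ^ α)) _ (by linarith : (k : ℝ) < k + 1)
    (fun t ht => (hd t (by linarith [ht.1])).continuousAt.continuousWithinAt)
    (fun t ht => hd t (by linarith [ht.1]))
    (fun t : ℝ => Real.exp (t ^ α)) _
    (fun t ht => (hasDerivAt_exp_rpow α (by linarith [ht.1])).continuousAt.continuousWithinAt)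
    (fun t ht => hasDerivAt_exp_rpow α (by linarith [ht.1]))
  have hc0 : 0 < c := by linarith
  have e1 : Real.exp (((k : ℝ) + 1) ^ α) - Real.exp ((k : ℝ) ^ α) = expIncrement α k := by
    simp [expIncrement]
  have e2 : Real.exp (((k : ℝ) + 1 + 1) ^ α) - Real.exp (((k : ℝ) + 1) ^ α) =
      expIncrement α (k + 1) := by
    simp [expIncrement]
  rw [e1, e2] at hc
  have hα0 : 0 < α := by linarith
  have hlog := congrArg Real.log hc
  have hp1 : 0 < c ^ (α - 1) := Real.rpow_pos_of_pos hc0 _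
  have hp2 : 0 < (c + 1) ^ (α - 1) := Real.rpow_pos_of_pos (by linarith) _
  rw [Real.log_mul (expIncrement_pos hα _).ne' (by positivity),
    Real.log_mul (expIncrement_pos hα _).ne' (by positivity),
    Real.log_mul (Real.exp_pos _).ne' (by positivity), Real.log_exp,
    Real.log_mul (Real.exp_pos _).ne' (by positivity), Real.log_exp,
    Real.log_mul hα0.ne' hp1.ne', Real.log_mul hα0.ne' hp2.ne', Real.log_rpow hc0,
    Real.log_rpow (by linarith)] at hlog
  have hl0 : 0 ≤ Real.log (c + 1) - Real.log c :=
    sub_nonneg.2 (Real.log_le_log hc0 (by linarith))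
  have hl1 : Real.log (c + 1) - Real.log c ≤ 1 / 16 * (1 / √(k : ℝ) * 4) := by
    have hs4 : (4 : ℝ) ≤ √(k : ℝ) := Real.le_sqrt_of_sq_le (by linarith)
    have hsk := Real.sq_sqrt (show (0 : ℝ) ≤ k by linarith)
    have h1 : Real.log (c + 1) - Real.log c ≤ 1 / c := by
      rw [← Real.log_div (by linarith) hc0.ne']
      refine (Real.log_le_sub_one_of_pos (by positivity)).trans (le_of_eq ?_)
      field_simp
      ring
    refine h1.trans ?_
    rw [show (1 : ℝ) / 16 * (1 / √(k : ℝ) * 4) = 1 / (4 * √(k : ℝ)) by field_simp; norm_num]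
    exact one_div_le_one_div_of_le (by positivity) (by nlinarith)
  have hgrow := sqrt_sub_sqrt_le_rpow_sub_rpow hα hc0.le (by linarith : c ≤ c + 1) (by linarith)
  have hsq := one_div_two_mul_sqrt_le hc0.le
  have hsk0 : 0 < √(k : ℝ) := Real.sqrt_pos.2 (by linarith)
  have hsq' : 3 / 8 * (1 / √(k : ℝ)) ≤ 1 / (2 * √(c + 1)) := by
    have h1 : √(c + 1) ≤ 4 / 3 * √(k : ℝ) := by
      rw [Real.sqrt_le_left (by positivity), mul_pow, Real.sq_sqrt (by linarith)]
      linarith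
    rw [show 3 / 8 * (1 / √(k : ℝ)) = 1 / (2 * (4 / 3 * √(k : ℝ))) by field_simp; norm_num]
    exact one_div_le_one_div_of_le (by positivity) (by linarith)
  have hdiff : √((k : ℝ) + 2) - √(k : ℝ) ≤ 1 / √(k : ℝ) := by
    have h1 := Real.sq_sqrt (show (0 : ℝ) ≤ k + 2 by linarith)
    have h2 := Real.sq_sqrt (show (0 : ℝ) ≤ k by linarith)
    have h3 : √(k : ℝ) ≤ √((k : ℝ) + 2) := Real.sqrt_le_sqrt (by linarith)
    rw [le_div_iff₀ hsk0]
    nlinarith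
  have hinv : 0 < 1 / √(k : ℝ) := by positivity
  nlinarith

theorem logDigit_succ (α : ℝ) (k : ℕ) :
    logDigit α (k + 1) = Real.log (expIncrement α k) - logDigit α k := rfl

/-- The recursion alternates signs, so only two-step differences are controlled: they equal the
differences of `log (expIncrement α k)`. The induction therefore carries both parities. -/
theorem tendsto_logDigit {α : ℝ} (hα : 1 / 2 ≤ α) : Tendsto (logDigit α) atTop atTop := by
  set c := min (logDigit α 16 - √(16 : ℝ) / 8) (logDigit α 17 - √(17 : ℝ) / 8) with hc
  have key : ∀ j : ℕ, c ≤ logDigit α (j + 16) - √((j + 16 : ℕ) : ℝ) / 8 ∧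
      c ≤ logDigit α (j + 17) - √((j + 17 : ℕ) : ℝ) / 8 := by
    intro j
    induction j with
    | zero => exact ⟨by simp [hc], by simp [hc]⟩
    | succ j ih =>
      refine ⟨by rw [show j + 1 + 16 = j + 17 by ring]; exact ih.2, ih.1.trans ?_⟩
      have h := sqrt_sub_sqrt_div_le_log_expIncrement_sub hα (k := j + 16) (by omega)
      have e := logDigit_succ α (j + 16 + 1)
      rw [logDigit_succ α (j + 16)] at e
      rw [show j + 1 + 17 = j + 16 + 1 + 1 by ring, e]
      push_cast at h ⊢
      rw [show (j : ℝ) + 16 + 1 + 1 = j + 16 + 2 by ring]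
      linarith
  have hlim : Tendsto (fun n : ℕ => c + √(n : ℝ) / 8) atTop atTop :=
    tendsto_atTop_add_const_left _ _ (tendsto_sqrt_natCast.atTop_div_const (by norm_num))
  refine tendsto_atTop_mono' _ ?_ hlim
  filter_upwards [eventually_ge_atTop 16] with n hn
  obtain ⟨j, rfl⟩ := Nat.exists_eq_add_of_le' hn
  linarith [(key j).1]

theorem exists_le_logDigit {α : ℝ} (hα : 1 / 2 ≤ α) : ∃ c, 0 ≤ c ∧ ∀ k, -c ≤ logDigit α k := by
  obtain ⟨b, hb⟩ := (isBoundedUnder_of_eventually_ge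
    ((tendsto_logDigit hα).eventually_ge_atTop 0)).bddBelow_range
  refine ⟨|b|, abs_nonneg b, fun k => ?_⟩
  linarith [hb (Set.mem_range_self k), neg_abs_le b]

theorem logDigit_le {α c : ℝ} (hα : 1 / 2 ≤ α) (hc0 : 0 ≤ c) (hc : ∀ k, -c ≤ logDigit α k) (n : ℕ) :
    logDigit α n ≤ (n : ℝ) ^ α + c := by
  cases n with
  | zero =>
    rw [logDigit]
    positivity
  | succ k =>
    rw [logDigit_succ]
    linarith [log_expIncrement_le hα k, hc k]

/-! ### Growth of the sums of logarithmic digits -/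

theorem rpow_add_one_le_sum {α : ℝ} (hα : 0 ≤ α) (n : ℕ) :
    (n : ℝ) ^ (α + 1) ≤ (α + 1) * (∑ k ∈ Finset.range n, (k : ℝ) ^ α + (n : ℝ) ^ α) := by
  have key : (n : ℝ) ^ (α + 1) ≤ (α + 1) * ∑ k ∈ Finset.range (n + 1), (k : ℝ) ^ α := by
    induction n with
    | zero =>
      rw [Nat.cast_zero, Real.zero_rpow (by linarith)]
      positivity
    | succ n ih =>
      rw [Finset.sum_range_succ, mul_add]
      have hn : (0 : ℝ) < (n : ℝ) + 1 := by positivity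
      -- Bernoulli's inequality for `(n / (n + 1)) ^ (α + 1)` bounds the increment of the left side.
      have hb := one_add_mul_self_le_rpow_one_add (s := -(1 / ((n : ℝ) + 1)))
        (by rw [neg_le_neg_iff, div_le_one hn]; linarith [(Nat.cast_nonneg n : (0 : ℝ) ≤ n)])
        (p := α + 1) (by linarith)
      have e1 : 1 + -(1 / ((n : ℝ) + 1)) = n / (n + 1) := by
        field_simp
        ring
      rw [e1, Real.div_rpow (Nat.cast_nonneg n) hn.le, le_div_iff₀ (Real.rpow_pos_of_pos hn _)] at hb
      have e2 : ((n : ℝ) + 1) ^ (α + 1) = ((n : ℝ) + 1) ^ α * (n + 1) := Real.rpow_add_one hn.ne' _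
      have e3 : (1 + (α + 1) * -(1 / ((n : ℝ) + 1))) * ((n : ℝ) + 1) ^ (α + 1) =
          ((n : ℝ) + 1) ^ (α + 1) - (α + 1) * ((n : ℝ) + 1) ^ α := by
        rw [e2]
        field_simp
        ring
      push_cast
      linarith
  rwa [Finset.sum_range_succ] at key

theorem two_mul_sum_logDigit (α : ℝ) (n : ℕ) :
    2 * ∑ k ∈ Finset.range n, logDigit α k =
      ∑ k ∈ Finset.range n, Real.log (expIncrement α k) - logDigit α n := by
  induction n with
  | zero => simp [logDigit]
  | succ n ih =>
    rw [Finset.sum_range_succ, Finset.sum_range_succ, mul_add, ih, logDigit_succ]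
    ring

theorem le_sum_log_expIncrement {α : ℝ} (hα : 1 / 2 ≤ α) (n : ℕ) :
    (n : ℝ) ^ (α + 1) / (α + 1) - (n : ℝ) ^ α - n * Real.log (2 * ((n : ℝ) + 1)) ≤
      ∑ k ∈ Finset.range n, Real.log (expIncrement α k) := by
  have h1 := rpow_add_one_le_sum (by linarith : 0 ≤ α) n
  have h2 : ∑ k ∈ Finset.range n, ((k : ℝ) ^ α - Real.log (2 * ((n : ℝ) + 1))) ≤
      ∑ k ∈ Finset.range n, Real.log (expIncrement α k) := by
    refine Finset.sum_le_sum fun k hk => le_trans ?_ (le_log_expIncrement hα k)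
    have hkn : (k : ℝ) ≤ n := by exact_mod_cast (Finset.mem_range.1 hk).le
    have hk0 : (0 : ℝ) ≤ k := Nat.cast_nonneg k
    have hs : √((k : ℝ) + 1) ≤ n + 1 := by
      rw [Real.sqrt_le_left (by linarith)]
      nlinarith
    have := Real.log_le_log (by positivity) (mul_le_mul_of_nonneg_left hs zero_le_two)
    linarith
  rw [Finset.sum_sub_distrib, Finset.sum_const, Finset.card_range, nsmul_eq_mul] at h2
  have h3 : (n : ℝ) ^ (α + 1) / (α + 1) ≤ ∑ k ∈ Finset.range n, (k : ℝ) ^ α + (n : ℝ) ^ α := by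
    rw [div_le_iff₀' (by linarith)]
    exact h1
  linarith

theorem eventually_log_le_mul_rpow {α : ℝ} (hα : 0 < α) {η : ℝ} (hη : 0 < η) :
    ∀ᶠ n : ℕ in atTop, Real.log (2 * ((n : ℝ) + 1)) ≤ η * (n : ℝ) ^ α := by
  have h1 := ((isLittleO_log_rpow_atTop hα).comp_tendsto tendsto_natCast_atTop_atTop).def
    (half_pos hη)
  have h2 := ((tendsto_rpow_atTop hα).comp tendsto_natCast_atTop_atTop).eventually_ge_atTop
    (Real.log 4 / (η / 2))
  filter_upwards [h1, h2, eventually_ge_atTop 1] with n hn1 hn2 hn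
  have hn' : (1 : ℝ) ≤ n := by exact_mod_cast hn
  simp only [Function.comp_apply] at hn1 hn2
  rw [div_le_iff₀ (half_pos hη)] at hn2
  rw [Real.norm_of_nonneg (Real.rpow_nonneg (by linarith) _)] at hn1
  have h3 : Real.log (2 * ((n : ℝ) + 1)) ≤ Real.log (4 * n) :=
    Real.log_le_log (by linarith) (by linarith)
  rw [Real.log_mul (by norm_num : (4 : ℝ) ≠ 0) (by linarith)] at h3
  linarith [(le_abs_self _).trans hn1]

theorem exists_sum_logDigit_le {α : ℝ} (hα : 1 / 2 ≤ α) {r : ℝ} (hr0 : 0 ≤ r) (hr : r < 1 / 2)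
    (a : ℝ) : ∃ C, ∀ n : ℕ, 2 * r * ∑ k ∈ Finset.range (n + 1), logDigit α k + a * (n + 1) +
      n * Real.log ((n : ℝ) + 1) ≤ C + ∑ k ∈ Finset.range n, logDigit α k := by
  obtain ⟨c, hc0, hc⟩ := exists_le_logDigit hα
  -- With `y = n ^ (α + 1)`, the main term `(1 - 2r) y / (2(α + 1))` equals `(5 + |a|) η y`. The
  -- losses are at most `2ηy` from the lower bound on the sum, `2ηy` from the last digit, `|a| η y`
  -- from the linear term, and `ηy` from the logarithm.
  set η := (1 - 2 * r) / (2 * (α + 1) * (5 + |a|)) with hη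
  have hα0 : 0 < α := by linarith
  have hη0 : 0 < η := div_pos (by linarith) (by positivity)
  have hev : ∀ᶠ n : ℕ in atTop, 0 ≤ ∑ k ∈ Finset.range n, logDigit α k -
      (2 * r * ∑ k ∈ Finset.range (n + 1), logDigit α k + a * (n + 1) +
        n * Real.log ((n : ℝ) + 1)) := by
    have t1 := tendsto_natCast_atTop_atTop (R := ℝ) |>.eventually_ge_atTop (1 / η)
    have t2 := ((tendsto_rpow_atTop hα0).comp tendsto_natCast_atTop_atTop).eventually_ge_atTop
      (2 / η)
    have t3 := ((tendsto_rpow_atTop hα0).comp tendsto_natCast_atTop_atTop).eventually_ge_atTop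
      (c / η)
    filter_upwards [t1, t2, t3, eventually_log_le_mul_rpow hα0 hη0, eventually_ge_atTop 1]
      with n h1 h2 h3 h4 hn
    simp only [Function.comp_apply] at h2 h3
    rw [div_le_iff₀ hη0] at h1 h2 h3
    have hn' : (1 : ℝ) ≤ n := by exact_mod_cast hn
    set z := (n : ℝ) ^ α with hz
    have hz0 : 0 < z := Real.rpow_pos_of_pos (by linarith) _
    have hy : (n : ℝ) ^ (α + 1) = z * n := Real.rpow_add_one (by linarith) _
    set y := z * n with hy'
    have hzy : z ≤ y := le_mul_of_one_le_right hz0.le hn'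
    have b1 : z ≤ η * y := by
      rw [hy']
      nlinarith
    have b2 : (n : ℝ) + 1 ≤ η * y := by
      rw [hy']
      nlinarith
    have b3 : c ≤ η * y := by nlinarith
    have b4 : n * Real.log (2 * ((n : ℝ) + 1)) ≤ η * y := by
      rw [hy']
      nlinarith
    have b5 : n * Real.log ((n : ℝ) + 1) ≤ η * y := by
      refine le_trans ?_ b4
      gcongr
      linarith
    have b6 : a * (n + 1) ≤ |a| * (η * y) :=
      mul_le_mul (le_abs_self a) b2 (by linarith) (abs_nonneg a)
    have g1 := le_sum_log_expIncrement hα n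
    have g2 := two_mul_sum_logDigit α n
    have g3 := logDigit_le hα hc0 hc n
    rw [hy] at g1
    have g4 : y / (α + 1) - 4 * (η * y) ≤ 2 * ∑ k ∈ Finset.range n, logDigit α k := by
      rw [g2]
      linarith
    have g5 : 2 * r * logDigit α n ≤ 2 * (η * y) := by
      have : logDigit α n ≤ 2 * (η * y) := by linarith
      have hy0 : 0 ≤ 2 * (η * y) := by positivity
      nlinarith
    have g6 : (1 - 2 * r) * (y / (α + 1)) = 2 * (5 + |a|) * (η * y) := by
      rw [hη]
      field_simp
    have hy0 : 0 ≤ η * y := by positivity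
    rw [Finset.sum_range_succ]
    nlinarith [mul_le_mul_of_nonneg_left g4 (by linarith : 0 ≤ 1 - 2 * r)]
  obtain ⟨b, hb⟩ : BddBelow (Set.range fun n : ℕ => ∑ k ∈ Finset.range n, logDigit α k -
      (2 * r * ∑ k ∈ Finset.range (n + 1), logDigit α k + a * (n + 1) +
        n * Real.log ((n : ℝ) + 1))) := by
    have := isBoundedUnder_of_eventually_ge hev
    exact this.bddBelow_range
  refine ⟨-b, fun n => ?_⟩
  have := hb (Set.mem_range_self n)
  linarith

/-! ### The digit windows and the lower bound -/

/-- The least digit of the `k`th window. -/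
def windowMin (α : ℝ) (k : ℕ) : ℕ := ⌈Real.exp (logDigit α k)⌉₊ + 1

/-- The number of digits of the `k`th window. -/
def windowSize (α : ℝ) (k : ℕ) : ℕ := ⌊Real.exp (logDigit α k) / (k + 1)⌋₊ + 1

theorem two_le_windowMin (α : ℝ) (k : ℕ) : 2 ≤ windowMin α k :=
  Nat.succ_le_succ (Nat.ceil_pos.2 (Real.exp_pos _))

theorem exp_logDigit_mul_succ {α : ℝ} (hα : 1 / 2 ≤ α) (k : ℕ) :
    Real.exp (logDigit α k) * Real.exp (logDigit α (k + 1)) = expIncrement α k := by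
  rw [← Real.exp_add, logDigit_succ, add_sub_cancel, Real.exp_log (expIncrement_pos hα k)]

theorem windowMin_le (α : ℝ) (k : ℕ) : (windowMin α k : ℝ) ≤ Real.exp (logDigit α k) + 2 := by
  have := Nat.ceil_lt_add_one (Real.exp_pos (logDigit α k)).le
  rw [windowMin]
  push_cast
  linarith

theorem windowSize_le (α : ℝ) (k : ℕ) :
    (windowSize α k : ℝ) ≤ Real.exp (logDigit α k) / (k + 1) + 1 := by
  have := Nat.floor_le (show 0 ≤ Real.exp (logDigit α k) / (k + 1) by positivity)
  rw [windowSize]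
  push_cast
  linarith

theorem le_windowSize (α : ℝ) (k : ℕ) :
    Real.exp (logDigit α k) / (k + 1) ≤ (windowSize α k : ℝ) := by
  rw [windowSize]
  push_cast
  exact (Nat.lt_floor_add_one _).le

theorem tendsto_digit_div {α : ℝ} (hα : 1 / 2 ≤ α) {d : ℕ → ℕ}
    (hd : ∀ k, windowMin α k ≤ d k ∧ d k < windowMin α k + windowSize α k) :
    Tendsto (fun k => (d k : ℝ) / Real.exp (logDigit α k)) atTop (𝓝 1) := by
  have hinv : Tendsto (fun k => 3 * (Real.exp (logDigit α k))⁻¹) atTop (𝓝 0) := by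
    simpa using (tendsto_inv_atTop_zero.comp
      (Real.tendsto_exp_atTop.comp (tendsto_logDigit hα))).const_mul 3
  have hup : Tendsto (fun k : ℕ => 1 + 3 * (Real.exp (logDigit α k))⁻¹ + 1 / ((k : ℝ) + 1))
      atTop (𝓝 1) := by
    simpa using (hinv.const_add 1).add tendsto_one_div_add_atTop_nhds_zero_nat
  refine tendsto_of_tendsto_of_tendsto_of_le_of_le tendsto_const_nhds hup (fun k => ?_) fun k => ?_
  · have h1 : (windowMin α k : ℝ) ≤ d k := by exact_mod_cast (hd k).1
    have h2 : Real.exp (logDigit α k) ≤ windowMin α k := by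
      rw [windowMin]
      push_cast
      linarith [Nat.le_ceil (Real.exp (logDigit α k))]
    rw [le_div_iff₀ (Real.exp_pos _), one_mul]
    exact h2.trans h1
  · have h1 : (d k : ℝ) ≤ windowMin α k + windowSize α k := by exact_mod_cast (hd k).2.le
    have hE := Real.exp_pos (logDigit α k)
    have h2 := windowMin_le α k
    have h3 := windowSize_le α k
    have e : (1 + 3 * (Real.exp (logDigit α k))⁻¹ + 1 / ((k : ℝ) + 1)) * Real.exp (logDigit α k) =
        Real.exp (logDigit α k) + 3 + Real.exp (logDigit α k) / (k + 1) := by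
      field_simp
    dsimp only
    rw [div_le_iff₀ hE, e]
    linarith

theorem sum_expIncrement {α : ℝ} (hα : α ≠ 0) (n : ℕ) :
    ∑ k ∈ Finset.range n, expIncrement α k = Real.exp ((n : ℝ) ^ α) - 1 := by
  have := Finset.sum_range_sub (fun k : ℕ => Real.exp ((k : ℝ) ^ α)) n
  simpa [expIncrement, Real.zero_rpow hα] using this

/-- Asymptotic equivalence of positive terms passes to partial sums because the sums of
`expIncrement α` diverge; these telescope to `exp (n ^ α) - 1`. -/
theorem cfValue_mem_levelSet {α : ℝ} (hα : 1 / 2 ≤ α) {d : ℕ → ℕ}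
    (hd : ∀ k, windowMin α k ≤ d k ∧ d k < windowMin α k + windowSize α k) :
    cfValue d ∈ levelSet fun n : ℕ => Real.exp ((n : ℝ) ^ α) := by
  have hα0 : 0 < α := by linarith
  have hd2 : ∀ k, 2 ≤ d k := fun k => (two_le_windowMin α k).trans (hd k).1
  have hmem := cfValue_mem_unitIrrationals hd2
  refine ⟨hmem.1, hmem.2, ?_⟩
  have hexp : Tendsto (fun n : ℕ => Real.exp ((n : ℝ) ^ α)) atTop atTop :=
    Real.tendsto_exp_atTop.comp ((tendsto_rpow_atTop hα0).comp tendsto_natCast_atTop_atTop)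
  have hsum : Tendsto (fun n => ∑ k ∈ Finset.range n, expIncrement α k) atTop atTop := by
    simp only [sum_expIncrement hα0.ne']
    exact tendsto_atTop_add_const_right _ (-1) hexp
  have hlim := tendsto_digit_div hα hd
  have hprod := hlim.mul (hlim.comp (tendsto_add_atTop_nat 1))
  have hequiv : Asymptotics.IsEquivalent atTop (fun k => (d k : ℝ) * d (k + 1))
      (expIncrement α) := by
    refine (Asymptotics.isEquivalent_iff_tendsto_one
      (Eventually.of_forall fun k => (expIncrement_pos hα k).ne')).2 ?_
    rw [one_mul] at hprod
    refine hprod.congr fun k => ?_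
    simp only [Function.comp_apply, Pi.div_apply]
    rw [div_mul_div_comm, exp_logDigit_mul_succ hα]
  have hlittle := Asymptotics.IsLittleO.sum_range hequiv
    (fun k => (expIncrement_pos hα k).le) hsum
  have hS : Asymptotics.IsEquivalent atTop
      (fun n => ∑ k ∈ Finset.range n, (d k : ℝ) * d (k + 1))
      fun n => ∑ k ∈ Finset.range n, expIncrement α k := by
    refine hlittle.congr_left fun n => ?_
    simp [Finset.sum_sub_distrib]
  have hE : Asymptotics.IsEquivalent atTop (fun n => ∑ k ∈ Finset.range n, expIncrement α k)
      fun n : ℕ => Real.exp ((n : ℝ) ^ α) := by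
    simp only [sum_expIncrement hα0.ne']
    refine (Asymptotics.IsEquivalent.refl).sub_isLittleO ?_
    refine Asymptotics.isLittleO_const_left.2 (Or.inr ?_)
    exact tendsto_norm_atTop_atTop.comp hexp
  have hfin := (Asymptotics.isEquivalent_iff_tendsto_one
    (Eventually.of_forall fun n : ℕ => (Real.exp_pos ((n : ℝ) ^ α)).ne')).1 (hS.trans hE)
  refine hfin.congr fun n => ?_
  rw [sumProd_cfValue hd2]
  rfl

theorem exists_window_bound {α : ℝ} (hα : 1 / 2 ≤ α) {r : ℝ} (hr0 : 0 ≤ r) (hr : r < 1 / 2) :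
    ∃ C : ℝ≥0, ∀ n, (2 * ∏ k ∈ Finset.range (n + 1),
      ((windowMin α k : ℝ) + windowSize α k) ^ 2) ^ r ≤
        C * ∏ k ∈ Finset.range n, (windowSize α k : ℝ) := by
  obtain ⟨c, hc0, hc⟩ := exists_le_logDigit hα
  -- With `E = exp (logDigit α k)`, a window ends by `2E + 3`, and `1 ≤ exp c * E` turns this into a
  -- multiple of `E`.
  set A := Real.log (2 + 3 * Real.exp c) with hA
  have hApos : 0 < 2 + 3 * Real.exp c := by positivity
  obtain ⟨C, hC⟩ := exists_sum_logDigit_le hα hr0 hr (r * (Real.log 2 + 2 * A))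
  have hup : ∀ k, (windowMin α k : ℝ) + windowSize α k ≤ Real.exp (A + logDigit α k) := by
    intro k
    have hE := Real.exp_pos (logDigit α k)
    have h1 := windowMin_le α k
    have h2 := windowSize_le α k
    have h3 : Real.exp (logDigit α k) / (k + 1) ≤ Real.exp (logDigit α k) :=
      div_le_self hE.le (by linarith [(Nat.cast_nonneg k : (0 : ℝ) ≤ k)])
    have h4 : 1 ≤ Real.exp c * Real.exp (logDigit α k) := by
      rw [← Real.exp_add]
      exact Real.one_le_exp (by linarith [hc k])
    rw [Real.exp_add, hA, Real.exp_log hApos]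
    nlinarith
  refine ⟨(Real.exp C).toNNReal, fun n => ?_⟩
  rw [Real.coe_toNNReal _ (Real.exp_pos C).le]
  have hleft : 2 * ∏ k ∈ Finset.range (n + 1), ((windowMin α k : ℝ) + windowSize α k) ^ 2 ≤
      Real.exp ((Real.log 2 + 2 * A) * (n + 1) +
        2 * ∑ k ∈ Finset.range (n + 1), logDigit α k) := by
    have h1 : ∏ k ∈ Finset.range (n + 1), ((windowMin α k : ℝ) + windowSize α k) ^ 2 ≤
        ∏ k ∈ Finset.range (n + 1), Real.exp (2 * (A + logDigit α k)) := by
      refine Finset.prod_le_prod (fun k _ => by positivity) fun k _ => ?_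
      rw [two_mul, Real.exp_add, ← sq]
      exact pow_le_pow_left₀ (by positivity) (hup k) 2
    rw [← Real.exp_sum, ← Finset.mul_sum, Finset.sum_add_distrib, Finset.sum_const,
      Finset.card_range, nsmul_eq_mul] at h1
    -- Wasteful, but it puts the factor 2 into the error term linear in `n + 1`.
    have h2 : (2 : ℝ) ≤ Real.exp (Real.log 2 * (n + 1)) := by
      nth_rw 1 [← Real.exp_log (two_pos : (0 : ℝ) < 2)]
      refine Real.exp_le_exp.2 ?_
      have := Real.log_nonneg (one_le_two : (1 : ℝ) ≤ 2)
      nlinarith [(Nat.cast_nonneg n : (0 : ℝ) ≤ n)]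
    refine (mul_le_mul h2 h1 (by positivity) (Real.exp_pos _).le).trans (le_of_eq ?_)
    rw [← Real.exp_add]
    push_cast
    ring_nf
  have hright : Real.exp (∑ k ∈ Finset.range n, logDigit α k - n * Real.log ((n : ℝ) + 1)) ≤
      ∏ k ∈ Finset.range n, (windowSize α k : ℝ) := by
    have h1 : ∏ k ∈ Finset.range n, Real.exp (logDigit α k - Real.log ((n : ℝ) + 1)) ≤
        ∏ k ∈ Finset.range n, (windowSize α k : ℝ) := by
      refine Finset.prod_le_prod (fun k _ => (Real.exp_pos _).le) fun k hk =>
        le_trans ?_ (le_windowSize α k)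
      have hkn : (k : ℝ) ≤ n := by exact_mod_cast (Finset.mem_range.1 hk).le
      rw [Real.exp_sub, Real.exp_log (by positivity)]
      gcongr
    rwa [← Real.exp_sum, Finset.sum_sub_distrib, Finset.sum_const, Finset.card_range,
      nsmul_eq_mul] at h1
  refine (Real.rpow_le_rpow (by positivity) hleft hr0).trans ?_
  refine le_trans ?_ (mul_le_mul_of_nonneg_left hright (Real.exp_pos C).le)
  rw [← Real.exp_mul, ← Real.exp_add]
  refine Real.exp_le_exp.2 ?_
  have := hC n
  linarith

theorem le_dimH_levelSet {α : ℝ} (hα : 1 / 2 ≤ α) :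
    1 / 2 ≤ dimH (levelSet fun n : ℕ => Real.exp ((n : ℝ) ^ α)) := by
  have e : (1 / 2 : ℝ≥0∞) = ((1 / 2 : ℝ≥0) : ℝ≥0∞) := by simp
  rw [e]
  refine ENNReal.le_of_forall_nnreal_lt fun r hr => ?_
  have hr' : (r : ℝ) < 1 / 2 := by exact_mod_cast hr
  rcases eq_or_ne r 0 with rfl | hr0
  · simp
  obtain ⟨C, hC⟩ := exists_window_bound hα r.coe_nonneg hr'
  exact le_dimH_of_digit_windows (two_le_windowMin α) (fun k => Nat.le_add_left _ _)
    (fun d hd => cfValue_mem_levelSet hα hd) (pos_iff_ne_zero.2 hr0) hC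

end

theorem theorem1p8 (α : ℝ) (hα : 1 / 2 ≤ α) :
    dimH (levelSet (fun n : ℕ => Real.exp ((n : ℝ) ^ α))) = 1 / 2 :=
  le_antisymm (dimH_levelSet_le hα) (le_dimH_levelSet hα)
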